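/- Let $k$, $n$ and $t$ be positive integers with $t \ge 303\, n \log_2 n$. Let $G$ be a simple graph on $n$ vertices, and let $c : E(G) \to \{1, \dots, t\}$ be an edge colouring (not necessarily proper) such that $|c^{-1}(i)| \ge k$ for every $i \in \{1, \dots, t\}$. Then $G$ contains a rainbow cycle of length at most $\lceil n/k \rceil$, that is, a cycle $C$ of $G$ with at most $\lceil n/k \rceil$ edges such that $c(e) \ne c(f)$ for all distinct edges $e, f$ of $C$. -/

import Mathlib

/-- A closed walk `p` of `G` is a *rainbow cycle* with respect to the edge colouring `c` if it is a
cycle and any two distinct edges of it have different colours. -/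
def SimpleGraph.Walk.IsRainbowCycle {V C : Type*} {G : SimpleGraph V} (c : G.edgeSet → C) {v : V}
    (p : G.Walk v v) : Prop :=
  p.IsCycle ∧ ∀ e f : G.edgeSet, (e : Sym2 V) ∈ p.edges → (f : Sym2 V) ∈ p.edges → e ≠ f → c e ≠ c f

/-! One edge of each colour gives a rainbow subgraph with more than `2 * n` edges. Such a graph has
a cycle of length at most `2 * log₂ n + 3`: around any vertex, some ball of radius at most `log₂ n`
contains at least half of the next larger ball. In the absence of short cycles, each edge inside
that larger ball joins a vertex to its unique neighbour nearer to the centre, so deleting the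
smaller ball destroys at most two edges per deleted vertex. Finally, counting edges bounds `k` by a
constant times `n / log₂ n`, which makes `2 * log₂ n + 3 ≤ n / k`. -/

section

open SimpleGraph

variable {V : Type*} {G : SimpleGraph V}

theorem isPath_eq_of_length_add_length_lt_egirth {u v : V} {p q : G.Walk u v} (hp : p.IsPath)
    (hq : q.IsPath) (h : ((p.length + q.length : ℕ) : ℕ∞) < G.egirth) : p = q := by
  by_contra hne
  obtain ⟨w, -, -, c, hc, hlen⟩ := hp.exists_isCycle_length_le_add_of_ne hq hne
  exact h.not_ge ((egirth_le_length hc).trans (mod_cast hlen))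

theorem penultimate_eq_of_adj_of_length_lt_egirth {v x y : V} {p : G.Walk v x} {q : G.Walk v y}
    (hp : p.IsPath) (hq : q.IsPath) (hxy : G.Adj x y) (hy : y ∉ p.support)
    (h : ((p.length + 1 + q.length : ℕ) : ℕ∞) < G.egirth) : q.penultimate = x := by
  have hpq : p.concat hxy = q :=
    isPath_eq_of_length_add_length_lt_egirth (hp.concat hy hxy) hq (by rwa [Walk.length_concat])
  rw [← hpq, Walk.penultimate_concat]

theorem exists_isPath_length_eq_dist_of_mem_ball {v x : V} {r : ℕ} (hx : x ∈ G.ball v r) :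
    ∃ p : G.Walk v x, p.IsPath ∧ p.length = G.dist v x ∧ p.length < r := by
  rw [mem_ball, edist_comm] at hx
  have hreach : G.Reachable v x := reachable_of_edist_ne_top hx.ne_top
  obtain ⟨p, hp, hlen⟩ := hreach.exists_path_of_dist
  rw [← hreach.coe_dist_eq_edist, ← hlen] at hx
  exact ⟨p, hp, hlen, mod_cast hx⟩

theorem exists_forall_eq_of_adj_of_dist_le {v y : V} {r : ℕ} (hr : ((2 * r : ℕ) : ℕ∞) ≤ G.egirth)
    (hy : y ∈ G.ball v r) :
    ∃ z, ∀ x ∈ G.ball v r, G.Adj x y → G.dist v x ≤ G.dist v y → x = z := by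
  classical
  obtain ⟨q, hq, -, hqr⟩ := exists_isPath_length_eq_dist_of_mem_ball hy
  refine ⟨q.penultimate, fun x hx hxy hle ↦ ?_⟩
  obtain ⟨p, hp, hdist, hpr⟩ := exists_isPath_length_eq_dist_of_mem_ball hx
  have hyp : y ∉ p.support := fun hmem ↦
    hle.not_gt (calc G.dist v y ≤ (p.takeUntil y hmem).length := dist_le _
      _ < p.length := Walk.length_takeUntil_lt_length hmem hxy.ne'
      _ = G.dist v x := hdist)
  have hlen : ((p.length + 1 + q.length : ℕ) : ℕ∞) < G.egirth :=
    (Nat.cast_lt.2 (by omega)).trans_le hr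
  exact (penultimate_eq_of_adj_of_length_lt_egirth hp hq hxy hyp hlen).symm

theorem ncard_edgeSet_inter_sym2_ball_le [Finite V] (v : V) {r : ℕ}
    (hr : ((2 * r : ℕ) : ℕ∞) ≤ G.egirth) :
    (G.edgeSet ∩ (G.ball v r).sym2).ncard ≤ (G.ball v r).ncard := by
  have : Nonempty V := ⟨v⟩
  choose! parent hparent using
    fun y (hy : y ∈ G.ball v r) ↦ exists_forall_eq_of_adj_of_dist_le hr hy
  have hsub : G.edgeSet ∩ (G.ball v r).sym2 ⊆ (fun y ↦ s(parent y, y)) '' G.ball v r := by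
    rintro ⟨x, y⟩ ⟨hxy, hx, hy⟩
    rcases le_total (G.dist v x) (G.dist v y) with hle | hle
    · exact ⟨y, hy, congrArg (s(·, y)) (hparent y hy x hx hxy hle).symm⟩
    · exact ⟨x, hx, (congrArg (s(·, x)) (hparent x hx y hy hxy.symm hle).symm).trans Sym2.eq_swap⟩
  exact (Set.ncard_le_ncard hsub).trans Set.ncard_image_le

theorem mem_ball_add_one_of_adj {v x y : V} {r : ℕ} (hx : x ∈ G.ball v r) (hxy : G.Adj x y) :
    y ∈ G.ball v (r + 1 : ℕ) := by
  rw [mem_ball, edist_comm] at *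
  calc G.edist v y ≤ G.edist v x + G.edist x y := G.edist_triangle
    _ = G.edist v x + 1 := by rw [edist_eq_one_iff_adj.2 hxy]
    _ < (r + 1 : ℕ) := by
      push_cast
      exact (ENat.add_lt_add_iff_right ENat.one_ne_top).2 hx

theorem exists_ncard_ball_le_mul [Finite V] (G : SimpleGraph V) (v : V) {b R : ℕ}
    (hR : Nat.card V < b ^ R) :
    ∃ r < R, (G.ball v (r + 2 : ℕ)).ncard ≤ b * (G.ball v (r + 1 : ℕ)).ncard := by
  by_contra! hgrow
  have hpow := geom_le (u := fun r ↦ ((G.ball v (r + 1 : ℕ)).ncard : ℝ)) (Nat.cast_nonneg b) R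
    fun r hr ↦ mod_cast (hgrow r hr).le
  simp only [zero_add, Nat.cast_one, ball_one, Set.ncard_singleton, mul_one] at hpow
  have hball : b ^ R ≤ (G.ball v (R + 1 : ℕ)).ncard := mod_cast hpow
  exact hR.not_ge (hball.trans (Set.ncard_le_card _))

theorem ncard_edgeSet_induce (G : SimpleGraph V) (s : Set V) :
    (G.induce s).edgeSet.ncard = (G.edgeSet ∩ s.sym2).ncard := by
  have himage : Sym2.map (↑) '' (G.induce s).edgeSet = G.edgeSet ∩ s.sym2 := by
    ext ⟨x, y⟩
    constructor
    · rintro ⟨⟨a, b⟩, hab, heq⟩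
      rw [← heq]
      exact ⟨hab, a.2, b.2⟩
    · rintro ⟨hxy, hx, hy⟩
      exact ⟨s(⟨x, hx⟩, ⟨y, hy⟩), hxy, rfl⟩
  rw [← himage, Set.ncard_image_of_injective _ (Sym2.map.injective Subtype.val_injective)]

theorem ncard_edgeSet_le_mul_card {V : Type*} [Finite V] (G : SimpleGraph V) {b R : ℕ}
    (hR : Nat.card V < b ^ R) (hG : ((2 * (R + 1) : ℕ) : ℕ∞) ≤ G.egirth) :
    G.edgeSet.ncard ≤ b * Nat.card V := by
  induction hm : Nat.card V using Nat.strong_induction_on generalizing V with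
  | _ m ih =>
  subst hm
  rcases isEmpty_or_nonempty V with hV | ⟨⟨v⟩⟩
  · simp [Set.eq_empty_of_isEmpty G.edgeSet]
  obtain ⟨r, hrR, hr⟩ := exists_ncard_ball_le_mul G v hR
  set B := G.ball v (r + 1 : ℕ)
  set B' := G.ball v (r + 2 : ℕ)
  have hsplit : G.edgeSet ⊆ G.edgeSet ∩ (Bᶜ).sym2 ∪ G.edgeSet ∩ B'.sym2 := by
    have hBB' : B ⊆ B' := ball_mono (by gcongr; simp)
    rintro ⟨x, y⟩ (hxy : G.Adj x y)
    by_cases hx : x ∈ B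
    · exact .inr ⟨hxy, hBB' hx, mem_ball_add_one_of_adj hx hxy⟩
    by_cases hy : y ∈ B
    · exact .inr ⟨hxy, mem_ball_add_one_of_adj hy hxy.symm, hBB' hy⟩
    · exact .inl ⟨hxy, hx, hy⟩
  have hcard : B.ncard + Nat.card ↥Bᶜ = Nat.card V := Set.ncard_add_ncard_compl B
  have hB : 0 < B.ncard := (Set.ncard_pos B.toFinite).2 ⟨v, mem_ball_self (by simp)⟩
  have hfar : (G.edgeSet ∩ (Bᶜ).sym2).ncard ≤ b * Nat.card ↥Bᶜ := by
    rw [← ncard_edgeSet_induce]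
    have hgirth : G.egirth ≤ (G.induce Bᶜ).egirth :=
      IsContained.egirth_le ⟨(Embedding.induce Bᶜ).toCopy⟩
    exact ih _ (by omega) (G.induce Bᶜ) (by omega) (hG.trans hgirth) rfl
  have hnear : (G.edgeSet ∩ B'.sym2).ncard ≤ B'.ncard :=
    ncard_edgeSet_inter_sym2_ball_le v ((Nat.cast_le.2 (by omega)).trans hG)
  calc G.edgeSet.ncard
      ≤ (G.edgeSet ∩ (Bᶜ).sym2).ncard + (G.edgeSet ∩ B'.sym2).ncard :=
        (Set.ncard_le_ncard hsplit).trans (Set.ncard_union_le _ _)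
    _ ≤ b * Nat.card ↥Bᶜ + b * B.ncard := add_le_add hfar (hnear.trans hr)
    _ = b * Nat.card V := by rw [← hcard]; ring

theorem exists_isCycle_length_le_of_mul_card_lt [Finite V] {b : ℕ} (hb : 1 < b)
    (h : b * Nat.card V < G.edgeSet.ncard) :
    ∃ (v : V) (p : G.Walk v v), p.IsCycle ∧ p.length ≤ 2 * Nat.log b (Nat.card V) + 3 := by
  by_contra! hlong
  refine h.not_ge (ncard_edgeSet_le_mul_card G (Nat.lt_pow_succ_log_self hb _) ?_)
  exact le_egirth.2 fun v p hp ↦ Nat.cast_le.2 (hlong v p hp)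

/-- No two edges of the subgraph `H` have the same colour. As `c` colours the edges of the ambient
graph `G`, the edges of `H` enter as the edges of `G` that lie in `H`; this is meant for `H ≤ G`. -/
def IsRainbowSubgraph {C : Type*} (c : G.edgeSet → C) (H : SimpleGraph V) : Prop :=
  Set.InjOn c {e | (e : Sym2 V) ∈ H.edgeSet}

theorem exists_isRainbowSubgraph_ncard_edgeSet_eq_card {C : Type*} {c : G.edgeSet → C}
    (hc : c.Surjective) :
    ∃ H ≤ G, IsRainbowSubgraph c H ∧ H.edgeSet.ncard = Nat.card C := by
  obtain ⟨s, -, hs⟩ := (Set.surjOn_univ.2 hc).exists_bijOn_subset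
  have hedge : (fromEdgeSet (Subtype.val '' s)).edgeSet = Subtype.val '' s := by
    rw [edgeSet_fromEdgeSet, sdiff_eq_left, Set.disjoint_left]
    rintro _ ⟨e, -, rfl⟩
    exact G.not_isDiag_of_mem_edgeSet e.2
  refine ⟨fromEdgeSet (Subtype.val '' s), ?_, ?_, ?_⟩
  · rw [← edgeSet_subset_edgeSet, hedge]
    exact Subtype.coe_image_subset _ _
  · simpa [IsRainbowSubgraph, hedge] using hs.injOn
  · rw [hedge, Set.ncard_image_of_injective _ Subtype.val_injective, ← hs.injOn.ncard_image,
      hs.image_eq, Set.ncard_univ]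

theorem IsRainbowSubgraph.isRainbowCycle_mapLe {C : Type*} {c : G.edgeSet → C} {H : SimpleGraph V}
    (hc : IsRainbowSubgraph c H) (hHG : H ≤ G) {v : V} {p : H.Walk v v} (hp : p.IsCycle) :
    (p.mapLe hHG).IsRainbowCycle c := by
  have hmem (e : G.edgeSet) (he : (e : Sym2 V) ∈ (p.mapLe hHG).edges) :
      (e : Sym2 V) ∈ H.edgeSet := by
    rw [Walk.edges_mapLe_eq_edges] at he
    exact p.edges_subset_edgeSet he
  exact ⟨hp.mapLe hHG, fun e f he hf hne ↦ hc.ne (hmem e he) (hmem f hf) hne⟩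

theorem exists_isRainbowCycle_length_le [Finite V] {C : Type*} {c : G.edgeSet → C} {b : ℕ}
    (hc : c.Surjective) (hb : 1 < b) (hC : b * Nat.card V < Nat.card C) :
    ∃ (v : V) (p : G.Walk v v),
      p.IsRainbowCycle c ∧ p.length ≤ 2 * Nat.log b (Nat.card V) + 3 := by
  obtain ⟨H, hHG, hH, hcard⟩ := exists_isRainbowSubgraph_ncard_edgeSet_eq_card hc
  obtain ⟨v, p, hp, hlen⟩ := exists_isCycle_length_le_of_mul_card_lt hb (hC.trans_eq hcard.symm)
  exact ⟨v, p.mapLe hHG, hH.isRainbowCycle_mapLe hHG hp, by simpa using hlen⟩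

theorem card_mul_le_choose_two_of_le_ncard_preimage [Fintype V] {C : Type*} [Fintype C]
    {c : G.edgeSet → C} {k : ℕ} (hc : ∀ i, k ≤ (c ⁻¹' {i}).ncard) :
    Fintype.card C * k ≤ (Fintype.card V).choose 2 := by
  classical
  refine le_trans ?_ G.card_edgeFinset_le_card_choose_two
  rw [← G.card_edgeSet, mul_comm]
  refine Finset.mul_card_image_le_card_of_maps_to (s := Finset.univ) (f := c) (by simp) k ?_
  intro i _
  refine (hc i).trans_eq ?_
  rw [← Set.ncard_coe_finset]
  congr 1
  ext f
  simp

theorem two_mul_log_add_three_mul_le {n t k : ℕ} (hn : 2 ≤ n) (ht : 5 * n * Nat.log 2 n ≤ 2 * t)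
    (htk : t * k ≤ n.choose 2) : (2 * Nat.log 2 n + 3) * k ≤ n := by
  have hlog : 1 ≤ Nat.log 2 n := Nat.log_pos one_lt_two hn
  have hchoose : 2 * n.choose 2 ≤ n * n := by
    rw [Nat.choose_two_right]
    exact (Nat.mul_div_le _ _).trans (Nat.mul_le_mul_left n (n.sub_le 1))
  have hmul : n * (5 * Nat.log 2 n * k) ≤ n * n :=
    calc n * (5 * Nat.log 2 n * k) = 5 * n * Nat.log 2 n * k := by ring
      _ ≤ 2 * t * k := by gcongr
      _ ≤ n * n := by linarith
  calc (2 * Nat.log 2 n + 3) * k ≤ 5 * Nat.log 2 n * k := by gcongr; omega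
    _ ≤ n := Nat.le_of_mul_le_mul_left hmul (by omega)

end

theorem corollary2p2_general {V C : Type*} [Fintype V] [Fintype C] [Nonempty C]
    (G : SimpleGraph V) (k : ℕ) (hk : 0 < k)
    (hC : 5 / 2 * (Fintype.card V : ℝ) * Real.logb 2 (Fintype.card V) ≤ Fintype.card C)
    (c : G.edgeSet → C) (hc : ∀ i, k ≤ (c ⁻¹' {i}).ncard) :
    ∃ (v : V) (p : G.Walk v v), p.IsRainbowCycle c ∧ p.length ≤ Fintype.card V / k := by
  set n := Fintype.card V
  have hcount : Fintype.card C * k ≤ n.choose 2 := card_mul_le_choose_two_of_le_ncard_preimage hc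
  have hn2 : 2 ≤ n := by
    by_contra! hlt
    rw [Nat.choose_eq_zero_of_lt hlt] at hcount
    exact hcount.not_gt (Nat.mul_pos Fintype.card_pos hk)
  have hlog : 5 * n * Nat.log 2 n ≤ 2 * Fintype.card C := by
    have : (5 * n * Nat.log 2 n : ℝ) ≤ 2 * Fintype.card C := by
      have := mul_le_mul_of_nonneg_left (Real.natLog_le_logb n 2) (Nat.cast_nonneg (α := ℝ) n)
      push_cast at this
      linarith
    exact_mod_cast this
  have hsurj : c.Surjective := fun i ↦ Set.nonempty_of_ncard_ne_zero (hk.trans_le (hc i)).ne'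
  have hcard : 2 * n < Fintype.card C := by
    have : 1 ≤ Nat.log 2 n := Nat.log_pos one_lt_two hn2
    nlinarith
  obtain ⟨v, p, hp, hlen⟩ := exists_isRainbowCycle_length_le hsurj one_lt_two (by simpa using hcard)
  rw [Nat.card_eq_fintype_card] at hlen
  exact ⟨v, p, hp, hlen.trans
    ((Nat.le_div_iff_mul_le hk).2 (two_mul_log_add_three_mul_le hn2 hlog hcount))⟩

theorem corollary2p2 {V : Type*} [Fintype V] (G : SimpleGraph V) (n k t : ℕ)
    (hn : Fintype.card V = n) (hk : 0 < k) (ht : 0 < t)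
    (htn : 303 * (n : ℝ) * Real.logb 2 (n : ℝ) ≤ (t : ℝ))
    (c : G.edgeSet → Fin t) (hc : ∀ i : Fin t, k ≤ (c ⁻¹' {i}).ncard) :
    ∃ (v : V) (p : G.Walk v v), p.IsRainbowCycle c ∧ p.length ≤ ⌈(n : ℚ) / (k : ℚ)⌉₊ := by
  subst hn
  have : NeZero t := ⟨ht.ne'⟩
  have hlog : 0 ≤ Real.logb 2 (Fintype.card V) :=
    (Nat.cast_nonneg _).trans (Real.natLog_le_logb _ 2)
  obtain ⟨v, p, hp, hlen⟩ := corollary2p2_general G k hk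
    (by rw [Fintype.card_fin]; exact htn.trans' (by gcongr; norm_num)) c hc
  have hfloor : ((Fintype.card V / k : ℕ) : ℚ) ≤ Fintype.card V / k := Nat.cast_div_le
  exact ⟨v, p, hp, hlen.trans (mod_cast hfloor.trans (Nat.le_ceil _))⟩
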